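/- Let $d\ge 1$ be an integer and let $u\in L^1(\mathbb R^d)\cap L^\infty(\mathbb R^d)$ be nonnegative. Let $u^*$ be its Schwarz symmetrization, $u^*(x)=\inf\{t\ge 0:\ \mathrm{meas}\{u>t\}\le \mathrm{meas}\,B(0,|x|)\}$, where $\mathrm{meas}$ is Lebesgue measure and $B(0,r)$ is the ball of $\mathbb R^d$ with centre $0$ and radius $r$. Let $K_d$ be the volume of the unit ball of $\mathbb R^d$. Then for every real $m$ with $0\le m\le d$, $$\int_{\mathbb R^d}|x|^m\bigl(u(x)-u^*(x)\bigr)\,dx\ \ge\ \frac{m}{4d}\,K_d^{-m/d}\,\|u\|_{L^1}^{-1+m/d}\,\|u\|_{L^\infty}^{-m/d}\,\|u-u^*\|_{L^1}^2 .$$ Here the right-hand side is read as $0$ if $u=0$. If $|x|^m(u-u^*)$ is not integrable, the inequality is understood in $[0,\infty]$ as $$\int_{\mathbb R^d}|x|^m(u-u^*)_+\,dx\ \ge\ \int_{\mathbb R^d}|x|^m(u-u^*)_-\,dx+\frac{m}{4d}\,K_d^{-m/d}\,\|u\|_{L^1}^{-1+m/d}\,\|u\|_{L^\infty}^{-m/d}\,\|u-u^*\|_{L^1}^2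 .$$ -/

import Mathlib

open MeasureTheory
open scoped NNReal ENNReal

namespace Rearrangement

noncomputable section

/-- The distribution function `μ_q(t) = meas {x ∈ ℝ^d : q x > t}`, `t ≥ 0`. -/
def distribution {d : ℕ} (q : EuclideanSpace ℝ (Fin d) → ℝ) (t : ℝ≥0) : ℝ≥0∞ :=
  volume {x | (t : ℝ) < q x}

/-- The pseudo-inverse `q♯(s) = inf {t ≥ 0 : μ_q(t) ≤ s}` of the distribution function,
with values in `[0, ∞]` (the infimum of the empty set is `∞`). -/
def sharp {d : ℕ} (q : EuclideanSpace ℝ (Fin d) → ℝ) (s : ℝ≥0∞) : ℝ≥0∞ :=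
  ⨅ (t : ℝ≥0) (_ : distribution q t ≤ s), (t : ℝ≥0∞)

/-- The Schwarz symmetrization `q*(x) = q♯(meas B(0, |x|))` on `ℝ^d`, as a real function.
For an essentially bounded `q` the value `q♯(s)` is finite for every `s`, so that `toReal`
loses nothing. -/
def schwarz {d : ℕ} (q : EuclideanSpace ℝ (Fin d) → ℝ) (x : EuclideanSpace ℝ (Fin d)) : ℝ :=
  (sharp q (volume (Metric.ball (0 : EuclideanSpace ℝ (Fin d)) ‖x‖))).toReal

/-- The volume `K_d` of the unit ball of `ℝ^d`. -/
def unitBallVolume (d : ℕ) : ℝ :=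
  (volume (Metric.ball (0 : EuclideanSpace ℝ (Fin d)) 1)).toReal

/-- The factor `(m / 4d) K_d^{-m/d} ‖u‖_{L¹}^{-1+m/d} ‖u‖_{L^∞}^{-m/d}`. -/
def stabilityConst {d : ℕ} (m : ℝ) (u : EuclideanSpace ℝ (Fin d) → ℝ) : ℝ :=
  m / (4 * (d : ℝ)) * unitBallVolume d ^ (-(m / (d : ℝ)))
    * (eLpNorm u 1 volume).toReal ^ (-1 + m / (d : ℝ))
    * (eLpNorm u ∞ volume).toReal ^ (-(m / (d : ℝ)))

end

end Rearrangement

/-!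
In the variable `s = |B(0, |x|)|` the weight `|x|^m` is a multiple of the concave power `s ^ p`,
`p = m / d`, and a superlevel set `B` of `u*` is the interval `s < |E|`, where `E` is the
superlevel set of `u` at the same level. Put `a = |E|` and `δ = |E \ B| = |B \ E|`. By the
bathtub principle the gap between the `s ^ p`-moments of `E` and `B` is smallest when `E` arises
from `B` by exchanging the shell `[a - δ, a)` for `[a, a + δ)`, where it is at least
`p a ^ (p - 1) δ ^ 2`. Integrating over all levels bounds the moment gap below by
`p ∫ a ^ (p - 1) δ ^ 2 dt`. Since `‖u - u*‖₁ = 2 ∫ δ dt`, Cauchy–Schwarz gives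
`‖u - u*‖₁² ≤ 4 ∫ a ^ (p - 1) δ ^ 2 dt ∫ a ^ (1 - p) dt`, and Hölder's inequality on the levels
`0 < t < ‖u‖_∞` gives `∫ a ^ (1 - p) dt ≤ ‖u‖₁ ^ (1 - p) ‖u‖_∞ ^ p`.
-/

namespace Rearrangement

section ConcavePower

theorem two_mul_rpow_le_add_rpow_add_sub_rpow {q a y : ℝ} (hq : q ≤ 0) (hy0 : 0 ≤ y)
    (hya : y < a) : 2 * a ^ q ≤ (a + y) ^ q + (a - y) ^ q := by
  have ha : 0 < a := hy0.trans_lt hya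
  have hadd : 0 < a + y := by linarith
  have hsub : 0 < a - y := by linarith
  have hprod : a ^ q * a ^ q ≤ (a + y) ^ q * (a - y) ^ q := by
    rw [← Real.mul_rpow ha.le ha.le, ← Real.mul_rpow hadd.le hsub.le]
    exact Real.rpow_le_rpow_of_nonpos (mul_pos hadd hsub) (by nlinarith) hq
  have := Real.rpow_pos_of_pos ha q
  have := Real.rpow_pos_of_pos hadd q
  have := Real.rpow_pos_of_pos hsub q
  -- AM-GM for `(a + y) ^ q` and `(a - y) ^ q`.
  nlinarith [sq_nonneg ((a + y) ^ q - (a - y) ^ q)]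

variable {p a : ℝ}

theorem two_mul_rpow_le_add_rpow_sub_sub_rpow (hp0 : 0 ≤ p) (hp1 : p ≤ 1) {s : ℝ}
    (hs0 : 0 ≤ s) (hsa : s ≤ a) :
    2 * p * a ^ (p - 1) * s ≤ (a + s) ^ p - (a - s) ^ p := by
  set F : ℝ → ℝ := fun y => (a + y) ^ p - (a - y) ^ p - 2 * p * a ^ (p - 1) * y with hF
  have hderiv : ∀ y ∈ Set.Ioo 0 a, HasDerivAt F
      (p * ((a + y) ^ (p - 1) + (a - y) ^ (p - 1) - 2 * a ^ (p - 1))) y := by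
    intro y hy
    have hadd : HasDerivAt (fun y => (a + y) ^ p) (1 * p * (a + y) ^ (p - 1)) y :=
      ((hasDerivAt_id y).const_add a).rpow_const (Or.inl (by simp; linarith [hy.1, hy.2]))
    have hsub : HasDerivAt (fun y => (a - y) ^ p) (-1 * p * (a - y) ^ (p - 1)) y :=
      ((hasDerivAt_id y).const_sub a).rpow_const (Or.inl (by simp; linarith [hy.2]))
    exact ((hadd.sub hsub).sub ((hasDerivAt_id y).const_mul (2 * p * a ^ (p - 1)))).congr_deriv
      (by ring)
  have hmono : MonotoneOn F (Set.Icc 0 a) := by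
    refine monotoneOn_of_deriv_nonneg (convex_Icc 0 a) (Continuous.continuousOn ?_) ?_ ?_
    · exact (((continuous_const_add a).rpow_const fun _ => Or.inr hp0).sub
        ((continuous_sub_left a).rpow_const fun _ => Or.inr hp0)).sub (continuous_const_mul _)
    · rw [interior_Icc]
      exact fun y hy => (hderiv y hy).differentiableAt.differentiableWithinAt
    · rw [interior_Icc]
      intro y hy
      rw [(hderiv y hy).deriv]
      exact mul_nonneg hp0 (sub_nonneg.2
        (two_mul_rpow_le_add_rpow_add_sub_rpow (by linarith) hy.1.le hy.2))
  have h0s : F 0 ≤ F s := hmono ⟨le_rfl, hs0.trans hsa⟩ ⟨hs0, hsa⟩ hs0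
  simp only [hF, add_zero, sub_zero, mul_zero, sub_self] at h0s
  linarith

theorem integral_rpow_sub_add_le_integral_rpow_add (hp0 : 0 ≤ p) (hp1 : p ≤ 1) {δ : ℝ}
    (hδ0 : 0 ≤ δ) (hδa : δ ≤ a) :
    (∫ s in (a - δ)..a, s ^ p) + p * a ^ (p - 1) * δ ^ 2 ≤ ∫ s in a..(a + δ), s ^ p := by
  have hadd : Continuous fun s : ℝ => (a + s) ^ p :=
    (continuous_const_add a).rpow_const fun _ => Or.inr hp0
  have hsub : Continuous fun s : ℝ => (a - s) ^ p :=
    (continuous_sub_left a).rpow_const fun _ => Or.inr hp0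
  have hlin : ∫ s in (0 : ℝ)..δ, 2 * p * a ^ (p - 1) * s = p * a ^ (p - 1) * δ ^ 2 := by
    rw [intervalIntegral.integral_const_mul, integral_id]
    ring
  calc (∫ s in (a - δ)..a, s ^ p) + p * a ^ (p - 1) * δ ^ 2
      = ∫ s in (0 : ℝ)..δ, ((a - s) ^ p + 2 * p * a ^ (p - 1) * s) := by
        rw [intervalIntegral.integral_add (hsub.intervalIntegrable _ _)
          ((continuous_const_mul _).intervalIntegrable _ _), hlin,
          intervalIntegral.integral_comp_sub_left (fun s : ℝ => s ^ p), sub_zero]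
    _ ≤ ∫ s in (0 : ℝ)..δ, (a + s) ^ p :=
        intervalIntegral.integral_mono_on hδ0
          ((hsub.add (continuous_const_mul _)).intervalIntegrable _ _)
          (hadd.intervalIntegrable _ _) fun s hs => by
            linarith [two_mul_rpow_le_add_rpow_sub_sub_rpow hp0 hp1 hs.1 (hs.2.trans hδa)]
    _ = ∫ s in a..(a + δ), s ^ p := by
        rw [intervalIntegral.integral_comp_add_left (fun s : ℝ => s ^ p), add_zero]

theorem setLIntegral_Ico_ofReal_rpow (hp0 : 0 ≤ p) (ha : 0 ≤ a) {b : ℝ} (hab : a ≤ b) :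
    ∫⁻ s in Set.Ico a b, ENNReal.ofReal s ^ p = ENNReal.ofReal (∫ s in a..b, s ^ p) := by
  have hcont : Continuous fun s : ℝ => s ^ p := continuous_id.rpow_const fun _ => Or.inr hp0
  rw [intervalIntegral.integral_of_le hab, ← integral_Ico_eq_integral_Ioc,
    ofReal_integral_eq_lintegral_ofReal (hcont.integrableOn_Icc.mono_set Set.Ico_subset_Icc_self)]
  · exact setLIntegral_congr_fun measurableSet_Ico fun s hs =>
      ENNReal.ofReal_rpow_of_nonneg (ha.trans hs.1) hp0
  · filter_upwards [ae_restrict_mem measurableSet_Ico] with s hs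
    exact Real.rpow_nonneg (ha.trans hs.1) p

theorem setLIntegral_Ico_ofReal_rpow_add_le (hp0 : 0 ≤ p) (hp1 : p ≤ 1) (ha : 0 < a) {δ : ℝ}
    (hδ0 : 0 ≤ δ) (hδa : δ ≤ a) :
    (∫⁻ s in Set.Ico (a - δ) a, ENNReal.ofReal s ^ p)
        + ENNReal.ofReal p * (ENNReal.ofReal a ^ (p - 1) * ENNReal.ofReal δ ^ 2)
      ≤ ∫⁻ s in Set.Ico a (a + δ), ENNReal.ofReal s ^ p := by
  rw [setLIntegral_Ico_ofReal_rpow hp0 (sub_nonneg.2 hδa) (by linarith),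
    setLIntegral_Ico_ofReal_rpow hp0 ha.le (by linarith), ENNReal.ofReal_rpow_of_pos ha,
    ← ENNReal.ofReal_pow hδ0, ← ENNReal.ofReal_mul (by positivity), ← ENNReal.ofReal_mul hp0,
    ← ENNReal.ofReal_add _ (by positivity), ← mul_assoc]
  · exact ENNReal.ofReal_le_ofReal (integral_rpow_sub_add_le_integral_rpow_add hp0 hp1 hδ0 hδa)
  · exact intervalIntegral.integral_nonneg (by linarith) fun s hs =>
      Real.rpow_nonneg (by linarith [hs.1]) p

end ConcavePower

section Bathtub

variable {α : Type*} [MeasurableSpace α] {μ : Measure α}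

theorem setLIntegral_le_setLIntegral_of_threshold {A F : Set α} (hA : MeasurableSet A)
    (hF : MeasurableSet F) (hAF : μ A = μ F) (hfin : μ F ≠ ∞) {h : α → ℝ≥0∞} {c : ℝ≥0∞}
    (hle : ∀ x ∈ A \ F, h x ≤ c) (hge : ∀ x ∈ F \ A, c ≤ h x) :
    ∫⁻ x in A, h x ∂μ ≤ ∫⁻ x in F, h x ∂μ := by
  have hsdiff : μ (A \ F) = μ (F \ A) :=
    measure_sdiff_symm hA.nullMeasurableSet hF.nullMeasurableSet hAF
      (measure_ne_top_of_subset Set.inter_subset_right hfin)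
  rw [← lintegral_inter_add_sdiff h A hF, ← lintegral_inter_add_sdiff h F hA, Set.inter_comm F A]
  refine add_le_add_right ?_ _
  calc ∫⁻ x in A \ F, h x ∂μ ≤ ∫⁻ _ in A \ F, c ∂μ := setLIntegral_mono' (hA.diff hF) hle
    _ = ∫⁻ _ in F \ A, c ∂μ := by simp only [setLIntegral_const, hsdiff]
    _ ≤ ∫⁻ x in F \ A, h x ∂μ := setLIntegral_mono' (hF.diff hA) hge

variable {V : α → ℝ}

theorem measurePreserving_restrict_Ici_of_measure_lt (hVm : Measurable V)
    (hV : ∀ s, μ {x | V x < s} = ENNReal.ofReal s) :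
    MeasurePreserving V μ (volume.restrict (Set.Ici 0)) := by
  refine ⟨hVm, (Measure.ext_of_Ico _ _ fun a b hab => ?_).symm⟩
  have hpre : V ⁻¹' Set.Ico a b = {x | V x < b} \ {x | V x < a} := by
    ext x
    simp [and_comm]
  have hsub : {x | V x < a} ⊆ {x | V x < b} := fun x (hx : V x < a) => hx.trans hab
  rw [Measure.restrict_apply measurableSet_Ico, Measure.map_apply hVm measurableSet_Ico, hpre,
    measure_sdiff hsub (measurableSet_lt hVm measurable_const).nullMeasurableSet
      (by rw [hV]; exact ENNReal.ofReal_ne_top), hV, hV, Set.Ico_inter_Ici, Real.volume_Ico]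
  rcases le_total a 0 with ha | ha
  · simp [ha, ENNReal.ofReal_of_nonpos ha]
  · rw [sup_of_le_left ha, ENNReal.ofReal_sub _ ha]

theorem measure_ofReal_lt (hV : MeasurePreserving V μ (volume.restrict (Set.Ici 0)))
    (c : ℝ≥0∞) : μ {x | ENNReal.ofReal (V x) < c} = c := by
  have hmeas : MeasurableSet {s : ℝ | ENNReal.ofReal s < c} :=
    measurableSet_lt ENNReal.measurable_ofReal measurable_const
  have hpre := hV.measure_preimage hmeas.nullMeasurableSet
  rw [Measure.restrict_apply hmeas] at hpre
  refine hpre.trans ?_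
  induction c with
  | top => simp
  | coe r =>
    have : {s : ℝ | ENNReal.ofReal s < r} ∩ Set.Ici 0 = Set.Ico 0 (r : ℝ) := by
      ext s
      simp only [Set.mem_inter_iff, Set.mem_ofPred_eq, Set.mem_Ici, Set.mem_Ico]
      rw [and_comm, and_congr_right fun hs : 0 ≤ s =>
        ENNReal.ofReal_lt_iff_lt_toReal hs ENNReal.coe_ne_top, ENNReal.coe_toReal]
    rw [this, Real.volume_Ico, sub_zero, ENNReal.ofReal_coe_nnreal]

variable {a b δ : ℝ}

theorem setLIntegral_preimage_Ico (hV : MeasurePreserving V μ (volume.restrict (Set.Ici 0)))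
    (ha : 0 ≤ a) {φ : ℝ → ℝ≥0∞} (hφ : Measurable φ) :
    ∫⁻ x in V ⁻¹' Set.Ico a b, φ (V x) ∂μ = ∫⁻ s in Set.Ico a b, φ s := by
  rw [hV.setLIntegral_comp_preimage measurableSet_Ico hφ,
    Measure.restrict_restrict measurableSet_Ico, Set.Ico_inter_Ici, sup_of_le_left ha]

theorem measure_preimage_Ico (hV : MeasurePreserving V μ (volume.restrict (Set.Ici 0)))
    (ha : 0 ≤ a) : μ (V ⁻¹' Set.Ico a b) = ENNReal.ofReal (b - a) := by
  simpa using setLIntegral_preimage_Ico hV ha (b := b) (φ := fun _ => 1) measurable_const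

variable {φ : ℝ → ℝ≥0∞} {A : Set α}

theorem setLIntegral_comp_le_setLIntegral_Ico
    (hV : MeasurePreserving V μ (volume.restrict (Set.Ici 0))) (hφ : Monotone φ)
    (hA : MeasurableSet A) (hAδ : μ A = ENNReal.ofReal δ) (hδa : δ ≤ a)
    (hAa : ∀ x ∈ A, V x < a) :
    ∫⁻ x in A, φ (V x) ∂μ ≤ ∫⁻ s in Set.Ico (a - δ) a, φ s := by
  have hshell : μ (V ⁻¹' Set.Ico (a - δ) a) = ENNReal.ofReal δ := by
    rw [measure_preimage_Ico hV (sub_nonneg.2 hδa), sub_sub_cancel]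
  rw [← setLIntegral_preimage_Ico hV (sub_nonneg.2 hδa) hφ.measurable]
  refine setLIntegral_le_setLIntegral_of_threshold (c := φ (a - δ)) hA
    (hV.measurable measurableSet_Ico) (hAδ.trans hshell.symm)
    (hshell ▸ ENNReal.ofReal_ne_top) (fun x hx => hφ ?_) fun x hx => hφ hx.1.1
  by_contra! hlt
  exact hx.2 ⟨hlt.le, hAa x hx.1⟩

theorem setLIntegral_Ico_le_setLIntegral_comp
    (hV : MeasurePreserving V μ (volume.restrict (Set.Ici 0))) (hφ : Monotone φ)
    (hA : MeasurableSet A) (hAδ : μ A = ENNReal.ofReal δ) (ha : 0 ≤ a)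
    (hAa : ∀ x ∈ A, a ≤ V x) :
    ∫⁻ s in Set.Ico a (a + δ), φ s ≤ ∫⁻ x in A, φ (V x) ∂μ := by
  have hshell : μ (V ⁻¹' Set.Ico a (a + δ)) = ENNReal.ofReal δ := by
    rw [measure_preimage_Ico hV ha, add_sub_cancel_left]
  rw [← setLIntegral_preimage_Ico hV ha hφ.measurable]
  refine setLIntegral_le_setLIntegral_of_threshold (c := φ (a + δ))
    (hV.measurable measurableSet_Ico) hA (hshell.trans hAδ.symm)
    (hAδ ▸ ENNReal.ofReal_ne_top) (fun x hx => hφ hx.1.2.le) fun x hx => hφ ?_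
  by_contra! hlt
  exact hx.2 ⟨hAa x hx.1, hlt⟩

theorem setLIntegral_rpow_sublevel_sdiff_add_le
    (hV : MeasurePreserving V μ (volume.restrict (Set.Ici 0))) {p : ℝ} (hp0 : 0 ≤ p) (hp1 : p ≤ 1)
    {E B : Set α} (hE : MeasurableSet E) (hEfin : μ E ≠ ∞)
    (hB : B = {x | ENNReal.ofReal (V x) < μ E}) :
    (∫⁻ x in B \ E, ENNReal.ofReal (V x) ^ p ∂μ)
        + ENNReal.ofReal p * (μ E ^ (p - 1) * μ (E \ B) ^ 2)
      ≤ ∫⁻ x in E \ B, ENNReal.ofReal (V x) ^ p ∂μ := by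
  rcases eq_or_ne (μ E) 0 with hE0 | hE0
  · have hB0 : B = ∅ := by simp [hB, hE0]
    simp [hB0, hE0]
  have hBm : MeasurableSet B :=
    hB ▸ measurableSet_lt hV.measurable.ennreal_ofReal measurable_const
  have hsdiff : μ (B \ E) = μ (E \ B) :=
    measure_sdiff_symm hBm.nullMeasurableSet hE.nullMeasurableSet
      (hB ▸ measure_ofReal_lt hV (μ E)) (measure_ne_top_of_subset Set.inter_subset_right hEfin)
  set a := (μ E).toReal
  set δ := (μ (E \ B)).toReal
  have ha0 : 0 < a := ENNReal.toReal_pos hE0 hEfin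
  have hμE : μ E = ENNReal.ofReal a := (ENNReal.ofReal_toReal hEfin).symm
  have hμδ : μ (E \ B) = ENNReal.ofReal δ :=
    (ENNReal.ofReal_toReal (measure_ne_top_of_subset Set.sdiff_subset hEfin)).symm
  have hδa : δ ≤ a := ENNReal.toReal_mono hEfin (measure_mono Set.sdiff_subset)
  have hmemB : ∀ x, x ∈ B ↔ V x < a := fun x => by
    rw [hB, Set.mem_ofPred_eq, hμE, ENNReal.ofReal_lt_ofReal_iff ha0]
  have hφ : Monotone fun s : ℝ => ENNReal.ofReal s ^ p :=
    (ENNReal.monotone_rpow_of_nonneg hp0).comp ENNReal.ofReal_mono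
  calc _ ≤ (∫⁻ s in Set.Ico (a - δ) a, ENNReal.ofReal s ^ p)
        + ENNReal.ofReal p * (ENNReal.ofReal a ^ (p - 1) * ENNReal.ofReal δ ^ 2) := by
        rw [← hμE, ← hμδ]
        gcongr
        exact setLIntegral_comp_le_setLIntegral_Ico hV hφ (hBm.diff hE) (hsdiff.trans hμδ) hδa
          fun x hx => (hmemB x).1 hx.1
    _ ≤ ∫⁻ s in Set.Ico a (a + δ), ENNReal.ofReal s ^ p :=
        setLIntegral_Ico_ofReal_rpow_add_le hp0 hp1 ha0 ENNReal.toReal_nonneg hδa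
    _ ≤ ∫⁻ x in E \ B, ENNReal.ofReal (V x) ^ p ∂μ :=
        setLIntegral_Ico_le_setLIntegral_comp hV hφ (hE.diff hBm) hμδ ha0.le
          fun x hx => not_lt.1 fun h => hx.2 ((hmemB x).2 h)

end Bathtub

section LayerCake

variable {α : Type*} [MeasurableSpace α] {μ : Measure α}

theorem volume_restrict_Ioi_zero_Ico {a : ℝ} (ha : 0 ≤ a) (b : ℝ) :
    volume.restrict (Set.Ioi 0) (Set.Ico a b) = ENNReal.ofReal (b - a) := by
  rw [restrict_Ioi_eq_restrict_Ici, Measure.restrict_apply measurableSet_Ico,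
    Set.inter_eq_left.2 (Set.Ico_subset_Ici_self.trans (Set.Ici_subset_Ici.2 ha)), Real.volume_Ico]

theorem measurable_measure_superlevel (μ : Measure α) (f : α → ℝ) :
    Measurable fun t => μ {x | t < f x} :=
  Antitone.measurable fun _ _ hst => measure_mono fun _ hx => hst.trans_lt hx

variable [SFinite μ] {f g : α → ℝ}

theorem measurable_measure_superlevel_sdiff (hf : Measurable f) (hg : Measurable g) :
    Measurable fun t => μ ({x | t < f x} \ {x | t < g x}) :=
  measurable_measure_prodMk_right ((measurableSet_lt measurable_snd (hf.comp measurable_fst)).diff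
    (measurableSet_lt measurable_snd (hg.comp measurable_fst)))

theorem lintegral_ofReal_sub_eq_lintegral_measure_sdiff (hf : Measurable f) (hg : Measurable g)
    (hg0 : ∀ x, 0 ≤ g x) :
    ∫⁻ x, ENNReal.ofReal (f x - g x) ∂μ
      = ∫⁻ t in Set.Ioi (0 : ℝ), μ ({x | t < f x} \ {x | t < g x}) := by
  have hS : MeasurableSet ({z : α × ℝ | z.2 < f z.1} \ {z | z.2 < g z.1}) :=
    (measurableSet_lt measurable_snd (hf.comp measurable_fst)).diff
      (measurableSet_lt measurable_snd (hg.comp measurable_fst))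
  have hslice : ∀ x, Prod.mk x ⁻¹' ({z : α × ℝ | z.2 < f z.1} \ {z | z.2 < g z.1})
      = Set.Ico (g x) (f x) := fun x => by
    ext t
    simp [and_comm]
  calc ∫⁻ x, ENNReal.ofReal (f x - g x) ∂μ
      = (μ.prod (volume.restrict (Set.Ioi 0))) ({z | z.2 < f z.1} \ {z | z.2 < g z.1}) := by
        simp only [Measure.prod_apply hS, hslice, volume_restrict_Ioi_zero_Ico (hg0 _)]
    _ = ∫⁻ t in Set.Ioi (0 : ℝ), μ ({x | t < f x} \ {x | t < g x}) :=
        Measure.prod_apply_symm hS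

theorem lintegral_mul_ofReal_sub_eq_lintegral_setLIntegral_sdiff (hf : Measurable f)
    (hg : Measurable g) (hg0 : ∀ x, 0 ≤ g x) {w : α → ℝ≥0∞} (hw : Measurable w) :
    ∫⁻ x, w x * ENNReal.ofReal (f x - g x) ∂μ
      = ∫⁻ t in Set.Ioi (0 : ℝ), ∫⁻ x in {x | t < f x} \ {x | t < g x}, w x ∂μ := by
  have hlayer := lintegral_ofReal_sub_eq_lintegral_measure_sdiff (μ := μ.withDensity w) hf hg hg0
  rw [lintegral_withDensity_eq_lintegral_mul _ hw (hf.fun_sub hg).ennreal_ofReal] at hlayer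
  refine hlayer.trans (lintegral_congr fun t => withDensity_apply _ ?_)
  exact (measurableSet_lt measurable_const hf).diff (measurableSet_lt measurable_const hg)

theorem lintegral_enorm_eq_lintegral_measure_superlevel (hf : Measurable f)
    (hf0 : ∀ x, 0 ≤ f x) :
    ∫⁻ x, ‖f x‖ₑ ∂μ = ∫⁻ t in Set.Ioi (0 : ℝ), μ {x | t < f x} := by
  have hlayer := lintegral_ofReal_sub_eq_lintegral_measure_sdiff (μ := μ) hf
    (measurable_const (a := (0 : ℝ))) fun _ => le_rfl
  simp only [sub_zero] at hlayer
  simp only [Real.enorm_of_nonneg (hf0 _), hlayer]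
  refine setLIntegral_congr_fun measurableSet_Ioi fun t (ht : 0 < t) => ?_
  simp [ht.not_gt]

end LayerCake

section WeightedCauchySchwarz

variable {β : Type*} [MeasurableSpace β] {ν : Measure β} {p : ℝ} {a δ : β → ℝ≥0∞}

theorem sq_lintegral_le_mul_lintegral_rpow (ha : Measurable a) (hδ : Measurable δ)
    (hfin : ∀ᵐ t ∂ν, a t ≠ ∞) (hzero : ∀ t, a t = 0 → δ t = 0) :
    (∫⁻ t, δ t ∂ν) ^ 2
      ≤ (∫⁻ t, a t ^ (p - 1) * δ t ^ 2 ∂ν) * ∫⁻ t, a t ^ (1 - p) ∂ν := by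
  have hsplit : ∀ᵐ t ∂ν,
      δ t = (a t ^ (p - 1) * δ t ^ 2) ^ (1 / 2 : ℝ) * (a t ^ (1 - p)) ^ (1 / 2 : ℝ) := by
    filter_upwards [hfin] with t hat
    rcases eq_or_ne (a t) 0 with h0 | h0
    · simp [hzero t h0]
    · rw [← ENNReal.mul_rpow_of_nonneg _ _ (by norm_num), mul_right_comm,
        ← ENNReal.rpow_add _ _ h0 hat, sub_add_sub_cancel, sub_self, ENNReal.rpow_zero, one_mul,
        ← ENNReal.rpow_ofNat, ← ENNReal.rpow_mul]
      norm_num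
  have hholder : ∫⁻ t, δ t ∂ν
      ≤ ((∫⁻ t, a t ^ (p - 1) * δ t ^ 2 ∂ν) * ∫⁻ t, a t ^ (1 - p) ∂ν) ^ (1 / 2 : ℝ) := by
    rw [lintegral_congr_ae hsplit, ENNReal.mul_rpow_of_nonneg _ _ (by norm_num)]
    exact ENNReal.lintegral_mul_norm_pow_le ((ha.pow_const _).mul (hδ.pow_const 2)).aemeasurable
      (ha.pow_const _).aemeasurable (by norm_num) (by norm_num) (by norm_num)
  refine (pow_le_pow_left' hholder 2).trans_eq ?_
  rw [← ENNReal.rpow_ofNat, ← ENNReal.rpow_mul]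
  norm_num

theorem lintegral_rpow_one_sub_le (hp0 : 0 ≤ p) (hp1 : p ≤ 1) (ha : Measurable a) :
    ∫⁻ t, a t ^ (1 - p) ∂ν ≤ (∫⁻ t, a t ∂ν) ^ (1 - p) * ν Set.univ ^ p := by
  simpa using ENNReal.lintegral_mul_norm_pow_le (μ := ν) ha.aemeasurable
    (aemeasurable_const (b := 1)) (sub_nonneg.2 hp1) hp0 (sub_add_cancel 1 p)

end WeightedCauchySchwarz

section RealIntegrals

variable {α : Type*} [MeasurableSpace α] {μ : Measure α} {f : α → ℝ}

theorem le_integral_of_lintegral_neg_add_le (hf : Integrable f μ) {c : ℝ}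
    (hc : (∫⁻ x, ENNReal.ofReal (-f x) ∂μ) + ENNReal.ofReal c
      ≤ ∫⁻ x, ENNReal.ofReal (f x) ∂μ) : c ≤ ∫ x, f x ∂μ := by
  have hpos : ∫⁻ x, ENNReal.ofReal (f x) ∂μ ≠ ∞ := hf.lintegral_lt_top.ne
  have hneg : ∫⁻ x, ENNReal.ofReal (-f x) ∂μ ≠ ∞ := hf.neg.lintegral_lt_top.ne
  rw [integral_eq_lintegral_pos_part_sub_lintegral_neg_part hf, le_sub_iff_add_le']
  calc _ ≤ (∫⁻ x, ENNReal.ofReal (-f x) ∂μ).toReal + (ENNReal.ofReal c).toReal :=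
        add_le_add_right ((le_max_left c 0).trans_eq ENNReal.toReal_ofReal'.symm) _
    _ ≤ (∫⁻ x, ENNReal.ofReal (f x) ∂μ).toReal := by
        rw [← ENNReal.toReal_add hneg ENNReal.ofReal_ne_top]
        exact ENNReal.toReal_mono hpos hc

theorem ofReal_integral_abs_le_eLpNorm_one (f : α → ℝ) :
    ENNReal.ofReal (∫ x, |f x| ∂μ) ≤ eLpNorm f 1 μ := by
  rw [eLpNorm_one_eq_lintegral_enorm]
  simpa only [Real.enorm_abs] using
    (Real.ofReal_le_enorm _).trans (enorm_integral_le_lintegral_enorm fun x => |f x|)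

end RealIntegrals

section RearrangementAlong

variable {α : Type*} [MeasurableSpace α] {μ : Measure α} {V : α → ℝ}

/-- `g` is the rearrangement of `f` that decreases along `V`: each superlevel set of `g` is a
sublevel set of `V`. When `V` pushes `μ` to Lebesgue measure on `[0, ∞)` that sublevel set has the
measure of the superlevel set of `f`. With `V x` the volume of the centred ball through `x`, this is
the Schwarz symmetrization. Only the levels `t ≥ 0` are constrained. -/
structure IsRearrangementAlong (μ : Measure α) (V f g : α → ℝ) : Prop where
  nonneg : ∀ x, 0 ≤ g x
  superlevel : ∀ t, 0 ≤ t → {x | t < g x} = {x | ENNReal.ofReal (V x) < μ {x | t < f x}}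

/-- The integral over the levels `t > 0` of `|E|^{p-1} |E \ B|²`, where `E = {f > t}` and
`B = {g > t}`: the lower bound for the gap between the `V^p`-moments of `f` and `g` that the
comparison of `E` with `B` yields level by level. -/
noncomputable def superlevelDeficit (μ : Measure α) (p : ℝ) (f g : α → ℝ) : ℝ≥0∞ :=
  ∫⁻ t in Set.Ioi (0 : ℝ),
    μ {x | t < f x} ^ (p - 1) * μ ({x | t < f x} \ {x | t < g x}) ^ 2

namespace IsRearrangementAlong

variable {f f' g : α → ℝ}

theorem congr_ae (hfg : IsRearrangementAlong μ V f g) (hff' : f =ᵐ[μ] f') :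
    IsRearrangementAlong μ V f' g := by
  refine ⟨hfg.nonneg, fun t ht => ?_⟩
  have hlevel : μ {x | t < f' x} = μ {x | t < f x} :=
    measure_congr (hff'.mono fun x hx => congrArg (t < ·) hx.symm)
  rw [hlevel, hfg.superlevel t ht]

theorem measurable (hfg : IsRearrangementAlong μ V f g) (hV : Measurable V) : Measurable g := by
  refine measurable_of_Ioi fun t => ?_
  rcases lt_or_ge t 0 with ht | ht
  · rw [show g ⁻¹' Set.Ioi t = Set.univ from
      Set.eq_univ_of_forall fun x => ht.trans_le (hfg.nonneg x)]
    exact MeasurableSet.univ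
  · rw [show g ⁻¹' Set.Ioi t = {x | ENNReal.ofReal (V x) < μ {x | t < f x}} from
      hfg.superlevel t ht]
    exact measurableSet_lt hV.ennreal_ofReal measurable_const

theorem measure_superlevel (hfg : IsRearrangementAlong μ V f g)
    (hV : MeasurePreserving V μ (volume.restrict (Set.Ici 0))) {t : ℝ} (ht : 0 ≤ t) :
    μ {x | t < g x} = μ {x | t < f x} := by
  rw [hfg.superlevel t ht, measure_ofReal_lt hV]

theorem lintegral_add_superlevelDeficit_le (hfg : IsRearrangementAlong μ V f g)
    (hV : MeasurePreserving V μ (volume.restrict (Set.Ici 0))) {p : ℝ} (hp0 : 0 ≤ p) (hp1 : p ≤ 1)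
    (hf : Measurable f) (hf0 : ∀ x, 0 ≤ f x) (hfi : Integrable f μ) :
    (∫⁻ x, ENNReal.ofReal (V x) ^ p * ENNReal.ofReal (g x - f x) ∂μ)
        + ENNReal.ofReal p * superlevelDeficit μ p f g
      ≤ ∫⁻ x, ENNReal.ofReal (V x) ^ p * ENNReal.ofReal (f x - g x) ∂μ := by
  have : SigmaFinite μ := .of_map μ hV.aemeasurable (hV.map_eq ▸ inferInstance)
  have hg : Measurable g := hfg.measurable hV.measurable
  have hw : Measurable fun x => ENNReal.ofReal (V x) ^ p :=
    hV.measurable.ennreal_ofReal.pow_const p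
  have hdeficit : Measurable fun t =>
      μ {x | t < f x} ^ (p - 1) * μ ({x | t < f x} \ {x | t < g x}) ^ 2 :=
    ((measurable_measure_superlevel μ f).pow_const _).mul
      ((measurable_measure_superlevel_sdiff hf hg).pow_const 2)
  rw [lintegral_mul_ofReal_sub_eq_lintegral_setLIntegral_sdiff hg hf hf0 hw,
    lintegral_mul_ofReal_sub_eq_lintegral_setLIntegral_sdiff hf hg hfg.nonneg hw,
    superlevelDeficit, ← lintegral_const_mul _ hdeficit,
    ← lintegral_add_right _ (hdeficit.const_mul _)]
  exact setLIntegral_mono' measurableSet_Ioi fun t (ht : 0 < t) =>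
    setLIntegral_rpow_sublevel_sdiff_add_le hV hp0 hp1 (measurableSet_lt measurable_const hf)
      (hfi.measure_gt_lt_top ht).ne (hfg.superlevel t ht.le)

theorem lintegral_enorm_sub_eq (hfg : IsRearrangementAlong μ V f g)
    (hV : MeasurePreserving V μ (volume.restrict (Set.Ici 0))) (hf : Measurable f)
    (hf0 : ∀ x, 0 ≤ f x) (hfi : Integrable f μ) :
    ∫⁻ x, ‖f x - g x‖ₑ ∂μ
      = 2 * ∫⁻ t in Set.Ioi (0 : ℝ), μ ({x | t < f x} \ {x | t < g x}) := by
  have : SigmaFinite μ := .of_map μ hV.aemeasurable (hV.map_eq ▸ inferInstance)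
  have hg : Measurable g := hfg.measurable hV.measurable
  have hparts : ∀ x, ‖f x - g x‖ₑ
      = ENNReal.ofReal (f x - g x) + ENNReal.ofReal (g x - f x) := fun x => by
    rw [Real.enorm_eq_ofReal_abs]
    rcases le_total (f x) (g x) with h | h
    · rw [abs_sub_comm, abs_of_nonneg (sub_nonneg.2 h), ENNReal.ofReal_of_nonpos (sub_nonpos.2 h),
        zero_add]
    · rw [abs_of_nonneg (sub_nonneg.2 h), ENNReal.ofReal_of_nonpos (sub_nonpos.2 h), add_zero]
  have hsdiff : ∀ t ∈ Set.Ioi (0 : ℝ), μ ({x | t < g x} \ {x | t < f x})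
      = μ ({x | t < f x} \ {x | t < g x}) := fun t (ht : 0 < t) =>
    measure_sdiff_symm (measurableSet_lt measurable_const hg).nullMeasurableSet
      (measurableSet_lt measurable_const hf).nullMeasurableSet (hfg.measure_superlevel hV ht.le)
      (measure_ne_top_of_subset Set.inter_subset_right (hfi.measure_gt_lt_top ht).ne)
  rw [lintegral_congr hparts, lintegral_add_left (hf.fun_sub hg).ennreal_ofReal,
    lintegral_ofReal_sub_eq_lintegral_measure_sdiff hf hg hfg.nonneg,
    lintegral_ofReal_sub_eq_lintegral_measure_sdiff hg hf hf0,
    setLIntegral_congr_fun measurableSet_Ioi hsdiff, two_mul]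

theorem sq_lintegral_enorm_sub_le (hfg : IsRearrangementAlong μ V f g)
    (hV : MeasurePreserving V μ (volume.restrict (Set.Ici 0))) {p : ℝ} (hp0 : 0 ≤ p) (hp1 : p ≤ 1)
    (hf : Measurable f) (hf0 : ∀ x, 0 ≤ f x) (hfi : Integrable f μ) {M : ℝ≥0}
    (hM : ∀ᵐ x ∂μ, f x ≤ M) :
    (∫⁻ x, ‖f x - g x‖ₑ ∂μ) ^ 2
      ≤ superlevelDeficit μ p f g * (4 * ((∫⁻ x, ‖f x‖ₑ ∂μ) ^ (1 - p) * (M : ℝ≥0∞) ^ p)) := by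
  have : SigmaFinite μ := .of_map μ hV.aemeasurable (hV.map_eq ▸ inferInstance)
  set a : ℝ → ℝ≥0∞ := fun t => μ {x | t < f x}
  set δ : ℝ → ℝ≥0∞ := fun t => μ ({x | t < f x} \ {x | t < g x})
  have ham : Measurable a := measurable_measure_superlevel μ f
  have hδm : Measurable δ :=
    measurable_measure_superlevel_sdiff hf (hfg.measurable hV.measurable)
  have hδa : ∀ t, δ t ≤ a t := fun t => measure_mono Set.sdiff_subset
  have haM : ∀ t, (M : ℝ) ≤ t → a t = 0 := fun t ht =>
    measure_mono_null (fun x (hx : t < f x) => not_le.2 (ht.trans_lt hx)) (ae_iff.1 hM)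
  have hδM : ∫⁻ t in Set.Ioi (0 : ℝ), δ t = ∫⁻ t in Set.Ioo (0 : ℝ) M, δ t := by
    rw [← lintegral_inter_add_sdiff δ (Set.Ioi 0) measurableSet_Iio, Set.Ioi_inter_Iio,
      setLIntegral_congr_fun (g := 0) (measurableSet_Ioi.diff measurableSet_Iio) fun t ht =>
        le_zero_iff.1 ((hδa t).trans (haM t (not_lt.1 ht.2)).le)]
    simp
  have hafin : ∀ᵐ t ∂volume.restrict (Set.Ioo (0 : ℝ) M), a t ≠ ∞ := by
    filter_upwards [ae_restrict_mem measurableSet_Ioo] with t ht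
    exact (hfi.measure_gt_lt_top ht.1).ne
  calc (∫⁻ x, ‖f x - g x‖ₑ ∂μ) ^ 2 = 4 * (∫⁻ t in Set.Ioo (0 : ℝ) M, δ t) ^ 2 := by
        rw [hfg.lintegral_enorm_sub_eq hV hf hf0 hfi, hδM]
        ring
    _ ≤ 4 * ((∫⁻ t in Set.Ioo (0 : ℝ) M, a t ^ (p - 1) * δ t ^ 2)
          * ((∫⁻ t in Set.Ioo (0 : ℝ) M, a t) ^ (1 - p) * ENNReal.ofReal M ^ p)) := by
        gcongr
        refine (sq_lintegral_le_mul_lintegral_rpow ham hδm hafin fun t h =>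
          le_zero_iff.1 ((hδa t).trans h.le)).trans (mul_le_mul_right ?_ _)
        simpa using lintegral_rpow_one_sub_le (ν := volume.restrict (Set.Ioo (0 : ℝ) M))
          hp0 hp1 ham
    _ ≤ 4 * (superlevelDeficit μ p f g
          * ((∫⁻ x, ‖f x‖ₑ ∂μ) ^ (1 - p) * (M : ℝ≥0∞) ^ p)) := by
        rw [lintegral_enorm_eq_lintegral_measure_superlevel hf hf0, superlevelDeficit,
          ENNReal.ofReal_coe_nnreal]
        have := sub_nonneg.2 hp1
        gcongr <;> exact Set.Ioo_subset_Ioi_self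
    _ = superlevelDeficit μ p f g
          * (4 * ((∫⁻ x, ‖f x‖ₑ ∂μ) ^ (1 - p) * (M : ℝ≥0∞) ^ p)) := mul_left_comm _ _ _

theorem lintegral_add_sq_eLpNorm_div_le (hfg : IsRearrangementAlong μ V f g)
    (hV : MeasurePreserving V μ (volume.restrict (Set.Ici 0))) {p : ℝ} (hp0 : 0 ≤ p) (hp1 : p ≤ 1)
    (hf0 : 0 ≤ᵐ[μ] f) (hfi : Integrable f μ) {M : ℝ≥0} (hM : ∀ᵐ x ∂μ, f x ≤ M) :
    (∫⁻ x, ENNReal.ofReal (V x) ^ p * ENNReal.ofReal (g x - f x) ∂μ)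
        + ENNReal.ofReal p * (eLpNorm (fun x => f x - g x) 1 μ ^ 2
          / (4 * (eLpNorm f 1 μ ^ (1 - p) * (M : ℝ≥0∞) ^ p)))
      ≤ ∫⁻ x, ENNReal.ofReal (V x) ^ p * ENNReal.ofReal (f x - g x) ∂μ := by
  obtain ⟨f', hf'm, hrange, hff'⟩ :=
    hfi.aemeasurable.exists_ae_eq_range_subset (t := Set.Ici 0) hf0 Set.nonempty_Ici
  have hf'0 : ∀ x, 0 ≤ f' x := fun x => hrange ⟨x, rfl⟩
  have hf'i : Integrable f' μ := hfi.congr hff'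
  have hf'g := hfg.congr_ae hff'
  have hf'M : ∀ᵐ x ∂μ, f' x ≤ M := by
    filter_upwards [hff', hM] with x hx hxM using hx ▸ hxM
  have hneg : ∫⁻ x, ENNReal.ofReal (V x) ^ p * ENNReal.ofReal (g x - f x) ∂μ
      = ∫⁻ x, ENNReal.ofReal (V x) ^ p * ENNReal.ofReal (g x - f' x) ∂μ :=
    lintegral_congr_ae (hff'.mono fun x hx => by simp only [hx])
  have hpos : ∫⁻ x, ENNReal.ofReal (V x) ^ p * ENNReal.ofReal (f x - g x) ∂μ
      = ∫⁻ x, ENNReal.ofReal (V x) ^ p * ENNReal.ofReal (f' x - g x) ∂μ :=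
    lintegral_congr_ae (hff'.mono fun x hx => by simp only [hx])
  have hdist : eLpNorm (fun x => f x - g x) 1 μ = ∫⁻ x, ‖f' x - g x‖ₑ ∂μ := by
    rw [eLpNorm_one_eq_lintegral_enorm]
    exact lintegral_congr_ae (hff'.mono fun x hx => by simp only [hx])
  rw [hneg, hpos, hdist, eLpNorm_congr_ae hff', eLpNorm_one_eq_lintegral_enorm]
  refine le_trans ?_ (hf'g.lintegral_add_superlevelDeficit_le hV hp0 hp1 hf'm hf'0 hf'i)
  gcongr
  exact ENNReal.div_le_of_le_mul
    (hf'g.sq_lintegral_enorm_sub_le hV hp0 hp1 hf'm hf'0 hf'i hf'M)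

end IsRearrangementAlong

end RearrangementAlong

section Schwarz

variable {d : ℕ}

theorem unitBallVolume_pos (d : ℕ) : 0 < unitBallVolume d :=
  ENNReal.toReal_pos (Metric.measure_ball_pos volume _ one_pos).ne' measure_ball_lt_top.ne

/-- The volume of the ball of `ℝ^d` centred at `0` through `x`. As a function of `x` it is uniformly
distributed on `[0, ∞)`, and Schwarz symmetrization is the rearrangement along it. -/
noncomputable def ballVolume (x : EuclideanSpace ℝ (Fin d)) : ℝ :=
  volume.real (Metric.ball (0 : EuclideanSpace ℝ (Fin d)) ‖x‖)

theorem ballVolume_nonneg (x : EuclideanSpace ℝ (Fin d)) : 0 ≤ ballVolume x :=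
  measureReal_nonneg

theorem volume_ball_zero [NeZero d] {r : ℝ} (hr : 0 ≤ r) :
    volume (Metric.ball (0 : EuclideanSpace ℝ (Fin d)) r)
      = ENNReal.ofReal (unitBallVolume d * r ^ d) := by
  rw [Measure.addHaar_ball volume _ hr, finrank_euclideanSpace_fin, mul_comm (unitBallVolume d),
    ENNReal.ofReal_mul (pow_nonneg hr d), unitBallVolume,
    ENNReal.ofReal_toReal measure_ball_lt_top.ne]

theorem ballVolume_eq [NeZero d] (x : EuclideanSpace ℝ (Fin d)) :
    ballVolume x = unitBallVolume d * ‖x‖ ^ d := by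
  have := (unitBallVolume_pos d).le
  rw [ballVolume, Measure.real, volume_ball_zero (norm_nonneg x),
    ENNReal.toReal_ofReal (by positivity)]

theorem norm_rpow_eq_mul_ballVolume_rpow [NeZero d] (m : ℝ) (x : EuclideanSpace ℝ (Fin d)) :
    ‖x‖ ^ m = unitBallVolume d ^ (-(m / d)) * ballVolume x ^ (m / d) := by
  have hK := unitBallVolume_pos d
  have hd : (d : ℝ) ≠ 0 := NeZero.ne _
  rw [ballVolume_eq, Real.mul_rpow hK.le (by positivity), ← mul_assoc, ← Real.rpow_add hK,
    neg_add_cancel, Real.rpow_zero, one_mul, ← Real.rpow_natCast, ← Real.rpow_mul (norm_nonneg x),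
    mul_div_cancel₀ _ hd]

theorem measurePreserving_ballVolume [NeZero d] :
    MeasurePreserving (ballVolume (d := d)) volume (volume.restrict (Set.Ici 0)) := by
  have hK := unitBallVolume_pos d
  refine measurePreserving_restrict_Ici_of_measure_lt ?_ fun s => ?_
  · simp only [funext ballVolume_eq]
    fun_prop
  rcases le_or_gt s 0 with hs | hs
  · have hempty : {x : EuclideanSpace ℝ (Fin d) | ballVolume x < s} = ∅ :=
      Set.eq_empty_of_forall_notMem fun x hx => hx.not_ge (hs.trans (ballVolume_nonneg x))
    rw [hempty, measure_empty, ENNReal.ofReal_of_nonpos hs]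
  · obtain ⟨r, hr0, hrd⟩ : ∃ r : ℝ, 0 ≤ r ∧ r ^ d = s / unitBallVolume d :=
      ⟨(s / unitBallVolume d) ^ (d : ℝ)⁻¹, by positivity,
        Real.rpow_inv_natCast_pow (by positivity) (NeZero.ne d)⟩
    have hball : {x : EuclideanSpace ℝ (Fin d) | ballVolume x < s} = Metric.ball 0 r := by
      ext x
      rw [mem_ball_zero_iff, ← pow_lt_pow_iff_left₀ (norm_nonneg x) hr0 (NeZero.ne d), hrd,
        lt_div_iff₀' hK, ← ballVolume_eq, Set.mem_ofPred_eq]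
    rw [hball, volume_ball_zero hr0, hrd, mul_div_cancel₀ _ hK.ne']

variable {q : EuclideanSpace ℝ (Fin d) → ℝ}

theorem distribution_antitone (q : EuclideanSpace ℝ (Fin d) → ℝ) : Antitone (distribution q) :=
  fun _ _ hst => measure_mono fun _ hx => (NNReal.coe_le_coe.2 hst).trans_lt hx

theorem sharp_le_coe_iff {s : ℝ≥0∞} {t : ℝ≥0} : sharp q s ≤ t ↔ distribution q t ≤ s := by
  -- The infimum is attained because the distribution function is right-continuous.
  refine ⟨fun hst => ?_, fun hst => iInf₂_le t hst⟩
  obtain ⟨τ, hτ, htτ, hlim⟩ := exists_seq_strictAnti_tendsto t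
  have hlevel : {x | (t : ℝ) < q x} = ⋃ n, {x | (τ n : ℝ) < q x} := by
    ext x
    simp only [Set.mem_ofPred_eq, Set.mem_iUnion]
    refine ⟨fun hx => ?_, fun ⟨n, hn⟩ => (NNReal.coe_lt_coe.2 (htτ n)).trans hn⟩
    exact ((NNReal.tendsto_coe.2 hlim).eventually_lt_const hx).exists
  have hmono : Monotone fun n => {x | (τ n : ℝ) < q x} := fun _ _ hmn _ hx =>
    (NNReal.coe_le_coe.2 (hτ.antitone hmn)).trans_lt hx
  rw [distribution, hlevel, hmono.measure_iUnion]
  refine iSup_le fun n => ?_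
  have hlt : sharp q s < τ n := hst.trans_lt (ENNReal.coe_lt_coe.2 (htτ n))
  simp only [sharp, iInf_lt_iff] at hlt
  obtain ⟨t', ht', hlt'⟩ := hlt
  exact (distribution_antitone q (ENNReal.coe_lt_coe.1 hlt').le).trans ht'

theorem isRearrangementAlong_schwarz {M : ℝ≥0} (hM : ∀ᵐ x, q x ≤ M) :
    IsRearrangementAlong volume ballVolume q (schwarz q) := by
  refine ⟨fun x => ENNReal.toReal_nonneg, fun t ht => Set.ext fun x => ?_⟩
  lift t to ℝ≥0 using ht
  have hM0 : distribution q M = 0 := by simpa only [distribution, ae_iff, not_le] using hM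
  have hfin : sharp q (volume (Metric.ball (0 : EuclideanSpace ℝ (Fin d)) ‖x‖)) ≠ ∞ :=
    ne_top_of_le_ne_top ENNReal.coe_ne_top (sharp_le_coe_iff.2 (hM0.le.trans zero_le))
  rw [Set.mem_ofPred_eq, Set.mem_ofPred_eq, ballVolume,
    ofReal_measureReal measure_ball_lt_top.ne, schwarz, ← ENNReal.coe_toReal t,
    ENNReal.toReal_lt_toReal ENNReal.coe_ne_top hfin, ← not_le, sharp_le_coe_iff, not_le]
  rfl

variable {m : ℝ} {u : EuclideanSpace ℝ (Fin d) → ℝ}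

theorem ofReal_stabilityConst_le (hm0 : 0 ≤ m) (hmd : m ≤ d) (hu1 : MemLp u 1 volume)
    (huinf : MemLp u ∞ volume) :
    ENNReal.ofReal (stabilityConst m u)
      ≤ ENNReal.ofReal (unitBallVolume d ^ (-(m / d))) * (ENNReal.ofReal (m / d)
        * (4 * (eLpNorm u 1 volume ^ (1 - m / d) * eLpNorm u ∞ volume ^ (m / d)))⁻¹) := by
  set p := m / d with hp
  have hp0 : 0 ≤ p := div_nonneg hm0 d.cast_nonneg
  have hp1 : 0 ≤ 1 - p := sub_nonneg.2 (div_le_one_of_le₀ hmd d.cast_nonneg)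
  have hK := (unitBallVolume_pos d).le
  have hconst : stabilityConst m u = unitBallVolume d ^ (-p) * (p * (4⁻¹
      * ((eLpNorm u 1 volume ^ (-1 + p)).toReal * (eLpNorm u ∞ volume ^ (-p)).toReal))) := by
    rw [stabilityConst, ← ENNReal.toReal_rpow, ← ENNReal.toReal_rpow, hp]
    ring
  have hinv : (4 * (eLpNorm u 1 volume ^ (1 - p) * eLpNorm u ∞ volume ^ p))⁻¹
      = 4⁻¹ * (eLpNorm u 1 volume ^ (-1 + p) * eLpNorm u ∞ volume ^ (-p)) := by
    rw [ENNReal.mul_inv (by simp) (by simp), ENNReal.mul_inv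
      (Or.inr (ENNReal.rpow_ne_top_of_nonneg hp0 huinf.2.ne))
      (Or.inl (ENNReal.rpow_ne_top_of_nonneg hp1 hu1.2.ne)), ← ENNReal.rpow_neg,
      ← ENNReal.rpow_neg, neg_sub, sub_eq_neg_add]
  rw [hconst, hinv, ENNReal.ofReal_mul (by positivity), ENNReal.ofReal_mul hp0,
    ENNReal.ofReal_mul (by positivity), ENNReal.ofReal_mul ENNReal.toReal_nonneg,
    ENNReal.ofReal_inv_of_pos (by norm_num), ENNReal.ofReal_ofNat]
  gcongr <;> exact ENNReal.ofReal_toReal_le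

theorem lintegral_norm_rpow_mul_schwarz_sub_add_le [NeZero d] (hm0 : 0 ≤ m) (hmd : m ≤ d)
    (hu0 : 0 ≤ᵐ[volume] u) (hu1 : MemLp u 1 volume) (huinf : MemLp u ∞ volume) :
    (∫⁻ x, ENNReal.ofReal (‖x‖ ^ m * (schwarz u x - u x)))
        + ENNReal.ofReal (stabilityConst m u)
          * eLpNorm (fun x => u x - schwarz u x) 1 volume ^ 2
      ≤ ∫⁻ x, ENNReal.ofReal (‖x‖ ^ m * (u x - schwarz u x)) := by
  have hp0 : 0 ≤ m / d := div_nonneg hm0 d.cast_nonneg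
  have hp1 : m / d ≤ 1 := div_le_one_of_le₀ hmd d.cast_nonneg
  have hK := (unitBallVolume_pos d).le
  have hM : ∀ᵐ x, u x ≤ (eLpNorm u ∞ volume).toNNReal := by
    filter_upwards [ae_le_eLpNormEssSup (f := u) (μ := volume)] with x hx
    rw [← eLpNorm_exponent_top, ← ofReal_norm] at hx
    exact (le_abs_self _).trans ((ENNReal.ofReal_le_iff_le_toReal huinf.2.ne).1 hx)
  have hweight : ∀ (x : EuclideanSpace ℝ (Fin d)) (y : ℝ), ENNReal.ofReal (‖x‖ ^ m * y)
      = ENNReal.ofReal (unitBallVolume d ^ (-(m / d)))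
        * (ENNReal.ofReal (ballVolume x) ^ (m / d) * ENNReal.ofReal y) := fun x y => by
    rw [norm_rpow_eq_mul_ballVolume_rpow, mul_assoc, ENNReal.ofReal_mul (by positivity),
      ENNReal.ofReal_mul (Real.rpow_nonneg (ballVolume_nonneg x) _),
      ENNReal.ofReal_rpow_of_nonneg (ballVolume_nonneg x) hp0]
  simp only [hweight, lintegral_const_mul' _ _ ENNReal.ofReal_ne_top]
  have hstab := (isRearrangementAlong_schwarz hM).lintegral_add_sq_eLpNorm_div_le
    measurePreserving_ballVolume hp0 hp1 hu0 (memLp_one_iff_integrable.1 hu1) hM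
  refine le_trans ?_ (mul_le_mul_right hstab _)
  rw [mul_add, ENNReal.coe_toNNReal huinf.2.ne, ENNReal.div_eq_inv_mul, ← mul_assoc, ← mul_assoc,
    mul_assoc (ENNReal.ofReal (unitBallVolume d ^ _)) _ (_⁻¹)]
  gcongr
  exact ofReal_stabilityConst_le hm0 hmd hu1 huinf

end Schwarz

end Rearrangement

/-- The integral of `|x|^m (u - u*)` has positive part `∫ |x|^m (u - u*)₊` and negative part
`∫ |x|^m (u - u*)₋` in `[0, ∞]`. The first assertion is the inequality for that integral in
`(-∞, ∞]` as soon as one of the two parts is finite, with the negative part moved to the other side;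
the second one is the inequality of real numbers when the integrand is integrable. -/
theorem corollary1 (d : ℕ) (hd : 1 ≤ d) (m : ℝ) (hm0 : 0 ≤ m) (hmd : m ≤ (d : ℝ))
    (u : EuclideanSpace ℝ (Fin d) → ℝ) (hu0 : 0 ≤ᵐ[volume] u)
    (hu1 : MemLp u 1 volume) (huinf : MemLp u ∞ volume) :
    ((∫⁻ x, ENNReal.ofReal (‖x‖ ^ m * (Rearrangement.schwarz u x - u x)))
        + ENNReal.ofReal (Rearrangement.stabilityConst m u)
          * eLpNorm (fun x => u x - Rearrangement.schwarz u x) 1 volume ^ 2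
      ≤ ∫⁻ x, ENNReal.ofReal (‖x‖ ^ m * (u x - Rearrangement.schwarz u x)))
    ∧ (Integrable (fun x => ‖x‖ ^ m * (u x - Rearrangement.schwarz u x)) volume →
        Rearrangement.stabilityConst m u
            * (∫ x, |u x - Rearrangement.schwarz u x|) ^ 2
          ≤ ∫ x, ‖x‖ ^ m * (u x - Rearrangement.schwarz u x)) := by
  have : NeZero d := ⟨by omega⟩
  have hstab := Rearrangement.lintegral_norm_rpow_mul_schwarz_sub_add_le hm0 hmd hu0 hu1 huinf
  refine ⟨hstab, fun hint => Rearrangement.le_integral_of_lintegral_neg_add_le hint ?_⟩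
  simp only [← mul_neg, neg_sub]
  refine le_trans ?_ hstab
  rw [ENNReal.ofReal_mul' (sq_nonneg _), ENNReal.ofReal_pow (integral_nonneg fun _ => abs_nonneg _)]
  gcongr
  exact Rearrangement.ofReal_integral_abs_le_eLpNorm_one _
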